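/- **Setting.** Let $k$ be an algebraically closed field of characteristic $0$, let $R=k[X_1,\dots,X_5]$ act on $\mathcal D=k[x_1,\dots,x_5]$ by differentiation ($X_i * f=\partial f/\partial x_i$), and for a subspace $\mathcal W\subseteq\mathcal D$ let $\mathrm{Ann}_R(\mathcal W)=\{F\in R: F*f=0 \text{ for all } f\in\mathcal W\}$. A graded Artinian quotient $A=R/I=\bigoplus_{0\le d\le j}A_d$ with $A_j\ne 0$ and $I_0=I_1=0$ is a *level algebra* of codimension $5$, socle degree $j$ and type $t$ if $\{x\in A: xA_1=0\}=A_j$ and $\dim_kA_j=t$. For integers $a,b,c\ge 2$ let $\mathcal M_P(d)$ be the set of monomials of degree $d$ in $x_1,\dots,x_5$ whose exponents of $x_1,x_2,x_3$ are at most $a-1,b-1,c-1$ respectively, and let $m_P(d)=\#\mathcal M_P(d)$. Integer parameters $(a,b,c,i,s)$ are *permissible* if $c\ge b\ge a\ge 2$, $i\ge abc$, $s\ge 1$ and $s\,m_P(abc-3)\ge m_P(i+3)$. For permissible parameters put $j=i+abc$. The family $H_1(a,b,c,i,s)$ consists of the algebras $R/\mathrm{Ann}_R(\mathcal E(C)+\mathcal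 F(C'))$, where $\mathcal E(C)$ is spanned by $s$ linear combinations of the monomials in $\mathcal M_P(j)$, with coefficient vector $C\in k^{s\,m_P(j)}$, and $\mathcal F(C')$ is spanned by one form of degree $j$ in $k[x_1,x_2,x_3]$, with coefficient vector $C'$. We say that $H_1(a,b,c,i,s)$ *has type $t$* if for all $C$ and $C'$ in suitable dense Zariski-open subsets of the respective coefficient spaces the algebra is level of codimension $5$, socle degree $j$ and type $t$. **Theorem.** Let $c\ge b\ge a\ge 2$. (i) For each fixed $i\ge abc$, put $s_0=\left\lceil\dfrac{2i-a-b-c+11}{2abc-a-b-c-1}\right\rceil$. Then $(a,b,c,i,s_0)$ is permissible, $H_1(a,b,c,i,s_0)$ has type $1+s_0$, and this is the smallest type of any $H_1(a,b,c,i,s)$ with $(a,b,c,i,s)$ permissible. (ii) Put $s_1=\left\lceil\dfrac{2abc-a-b-c+11}{2abc-a-b-c-1}\right\rceil$. Then $(a,b,c,abc,s_1)$ is permissible, $H_1(a,b,c,abc,s_1)$ has type $1+s_1$, and this is the smallest type of any $H_1(a,b,c,i,s)$ with $(a,b,c,i,s)$ permissible, for varying $i$ and $s$. Moreover $1+s_1=3$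 unless $(a,b,c)=(2,2,2)$, in which case $1+s_1=4$. (iii) For all $i,s$ with $(a,b,c,i,s)$ permissible, $H_1(a,b,c,i,s)$ has a type, and its type is at least $3$. -/

import Mathlib

open MvPolynomial

noncomputable section

namespace LevelAlg

/-! ### Polynomials as differential operators -/

section Action

variable {k : Type*} [Field k] {r : ℕ}

/-- The operator `∂/∂x_i` on `𝒟 = k[x_1, …, x_r]`, as a `k`-linear endomorphism. -/
def partialD (i : Fin r) : Module.End k (MvPolynomial (Fin r) k) :=
  (pderiv i).toLinearMap

theorem partialD_commute (i j : Fin r) :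
    Commute (partialD (k := k) i) (partialD j) := by
  refine LinearMap.ext fun f => ?_
  change pderiv i (pderiv j f) = pderiv j (pderiv i f)
  have h : ⁅pderiv (R := k) i, pderiv (R := k) j⁆ = 0 := by
    refine MvPolynomial.derivation_ext fun l => ?_
    classical
    rw [Derivation.commutator_apply]
    simp only [pderiv_X, Pi.single_apply]
    split_ifs <;> simp
  have h2 := congrArg (fun D => D f) h
  simp only [Derivation.commutator_apply, Derivation.zero_apply] at h2
  exact sub_eq_zero.mp h2

theorem partialD_pow_pairwise (E : Fin r →₀ ℕ) (S : Set (Fin r)) :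
    S.Pairwise (Function.onFun (Commute (S := Module.End k (MvPolynomial (Fin r) k)))
      fun i => partialD (k := k) i ^ E i) :=
  fun i _ j _ _ => (partialD_commute i j).pow_pow _ _

/-- The operator `∂^E = ∏_i (∂/∂x_i)^{E_i}`, by which the monomial `X^E` of `R` acts on `𝒟`. -/
def partialMon (E : Fin r →₀ ℕ) : Module.End k (MvPolynomial (Fin r) k) :=
  Finset.univ.noncommProd (fun i => partialD (k := k) i ^ E i) (partialD_pow_pairwise E _)

theorem partialMon_add (D E : Fin r →₀ ℕ) :
    partialMon (k := k) (D + E) = partialMon D * partialMon E := by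
  unfold partialMon
  rw [← Finset.noncommProd_mul_distrib]
  · exact Finset.noncommProd_congr rfl (fun i _ => by simp [pow_add]) _
  · exact fun i _ j _ _ => (partialD_commute i j).pow_pow _ _

theorem partialMon_single (i : Fin r) :
    partialMon (k := k) (Finsupp.single i 1) = partialD i := by
  have h : ∀ comm, (Finset.univ.erase i).noncommProd
      (fun l => partialD (k := k) l ^ (Finsupp.single i 1 : Fin r →₀ ℕ) l) comm = 1 := fun comm =>
    (Finset.noncommProd_eq_pow_card _ _ comm 1 fun l hl => by
      rw [Finsupp.single_eq_of_ne (Finset.ne_of_mem_erase hl), pow_zero]).trans (one_pow _)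
  refine (Finset.mul_noncommProd_erase Finset.univ (Finset.mem_univ i) _ _).symm.trans ?_
  refine (congrArg (partialD (k := k) i ^ (Finsupp.single i 1 : Fin r →₀ ℕ) i * ·) (h _)).trans ?_
  simp only [mul_one, Finsupp.single_eq_same, pow_one]

/-- The action `F * f` of `F ∈ R = k[X_1, …, X_r]` on `f ∈ 𝒟 = k[x_1, …, x_r]` as a differential
operator: linear in `F`, with `X^E` acting as `∂^E`. -/
def diffAct : MvPolynomial (Fin r) k →ₗ[k] Module.End k (MvPolynomial (Fin r) k) :=
  (basisMonomials (Fin r) k).constr k partialMon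

theorem diffAct_monomial (E : Fin r →₀ ℕ) (c : k) :
    diffAct (monomial E c) = c • partialMon E := by
  have h : monomial E c = c • basisMonomials (Fin r) k E := by
    simp [coe_basisMonomials, smul_monomial]
  rw [h, map_smul, diffAct, Module.Basis.constr_basis]

theorem diffAct_X (i : Fin r) (f : MvPolynomial (Fin r) k) : diffAct (X i) f = pderiv i f := by
  rw [X, diffAct_monomial, partialMon_single, one_smul]
  rfl

theorem diffAct_mul (F G : MvPolynomial (Fin r) k) : diffAct (F * G) = diffAct F * diffAct G := by
  induction F using MvPolynomial.induction_on' with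
  | add p q hp hq => rw [add_mul, map_add, map_add, hp, hq, add_mul]
  | monomial D c =>
    induction G using MvPolynomial.induction_on' with
    | add p q hp hq => rw [mul_add, map_add, map_add, hp, hq, mul_add]
    | monomial E e =>
      rw [monomial_mul, diffAct_monomial, diffAct_monomial, diffAct_monomial, partialMon_add,
        smul_mul_smul_comm]

/-- `Ann_R(𝒲) = {F ∈ R | F * f = 0 for all f ∈ 𝒲}`, for a vector subspace `𝒲 ⊆ 𝒟`. -/
def annIdeal (W : Submodule k (MvPolynomial (Fin r) k)) : Ideal (MvPolynomial (Fin r) k) where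
  carrier := {F | ∀ f ∈ W, diffAct F f = 0}
  zero_mem' := fun f _ => by simp
  add_mem' := fun {F G} hF hG f hf => by
    rw [map_add, LinearMap.add_apply, hF f hf, hG f hf, add_zero]
  smul_mem' := fun G F hF f hf => by
    rw [smul_eq_mul, diffAct_mul, Module.End.mul_apply, hF f hf, map_zero]

end Action

/-! ### Level algebras -/

section Level

variable {k : Type*} [Field k] {r : ℕ}

/-- `A_d = R_d / I_d`, as a subspace of `A = R / I`. -/
def gradedPiece (I : Ideal (MvPolynomial (Fin r) k)) (d : ℕ) :
    Submodule k (MvPolynomial (Fin r) k ⧸ I) :=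
  (homogeneousSubmodule (Fin r) k d).map (Ideal.Quotient.mkₐ k I).toLinearMap

/-- The socle of `A = R / I`: the annihilator of the linear part `A_1`. -/
def socle (I : Ideal (MvPolynomial (Fin r) k)) : Set (MvPolynomial (Fin r) k ⧸ I) :=
  {x | ∀ l ∈ gradedPiece I 1, x * l = 0}

/-- `A = R / I`, with `R` a polynomial ring in `r` variables, is a (standard graded Artinian)
level algebra of codimension `r`, socle degree `j` and type `t`. -/
structure IsLevelOfType (I : Ideal (MvPolynomial (Fin r) k)) (j t : ℕ) : Prop where
  /-- `I` is a homogeneous ideal -/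
  homogeneous : ∀ F ∈ I, ∀ d, homogeneousComponent d F ∈ I
  /-- codimension `r`: the ideal contains no nonzero form of degree `0` or `1` -/
  codim : ∀ d ≤ 1, ∀ F ∈ I, F.IsHomogeneous d → F = 0
  artinian : Module.Finite k (MvPolynomial (Fin r) k ⧸ I)
  /-- `j` is the largest degree in which `A` is nonzero -/
  top_ne_bot : gradedPiece I j ≠ ⊥
  above_top : ∀ d, j < d → gradedPiece I d = ⊥
  level : socle I = (gradedPiece I j : Set (MvPolynomial (Fin r) k ⧸ I))
  type_eq : Module.finrank k (gradedPiece I j) = t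

end Level

/-! ### Zariski-general points of affine space -/

section General

variable {k : Type*} [Field k] {ι : Type*}

/-- Zariski-open subsets of the affine space `k^ι`: complements of common zero sets of
polynomials. -/
def IsZariskiOpen (U : Set (ι → k)) : Prop :=
  ∃ S : Set (MvPolynomial ι k), U = {x | ∀ p ∈ S, eval x p = 0}ᶜ

/-- `U` is a dense Zariski-open subset of `k^ι`: it is Zariski-open and meets every nonempty
Zariski-open set. -/
def IsDenseZariskiOpen (U : Set (ι → k)) : Prop :=
  IsZariskiOpen U ∧ ∀ V : Set (ι → k), IsZariskiOpen V → V.Nonempty → (U ∩ V).Nonempty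

end General

/-! ### Constrained monomials and parameterized families of subspaces -/

section Family

/-- `ℳ_Q(d)`: the multi-indices `D = (D_1, …, D_r)` of degree `d` that are constrained by
`Q = (Q_1, …, Q_n)`, `n ≤ r`, i.e. `D_m ≤ Q_m` for `m = 1, …, n`. -/
def multiIdx {n r : ℕ} (h : n ≤ r) (Q : Fin n → ℕ) (d : ℕ) : Finset (Fin r →₀ ℕ) :=
  (Finset.univ.finsuppAntidiag d).filter fun D => ∀ m : Fin n, D (Fin.castLE h m) ≤ Q m

/-- The form `∑_{J ∈ ℳ} c_J x^J` with coefficient vector `c ∈ k^ℳ`. -/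
def formOf {k : Type*} [Field k] {r : ℕ} (M : Finset (Fin r →₀ ℕ)) (c : M → k) :
    MvPolynomial (Fin r) k :=
  ∑ J : M, monomial (J : Fin r →₀ ℕ) (c J)

/-- The member with parameter `C ∈ k^{s·#ℳ}` of the family of subspaces
`⟨f_1, …, f_s⟩ ⊆ 𝒲_ℳ`, where `f_m = ∑_{J ∈ ℳ} C_{m,J} x^J`. -/
def spanOf {k : Type*} [Field k] {r : ℕ} (M : Finset (Fin r →₀ ℕ)) (s : ℕ)
    (C : Fin s × M → k) : Submodule k (MvPolynomial (Fin r) k) :=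
  Submodule.span k (Set.range fun m : Fin s => formOf M fun J => C (m, J))

end Family

/-! ### The family `H₁(a, b, c, i, s)` -/

section H1

/-- `ℳ_P(d)` for `r = 5` and `P = (a-1, b-1, c-1)`. -/
def H1P (a b c d : ℕ) : Finset (Fin 5 →₀ ℕ) :=
  multiIdx (n := 3) (by norm_num) ![a - 1, b - 1, c - 1] d

/-- `ℳ_Q(d)` for `r = 5` and `Q = (j, j, j, 0, 0)`. -/
def H1Q (j d : ℕ) : Finset (Fin 5 →₀ ℕ) :=
  multiIdx (n := 5) le_rfl ![j, j, j, 0, 0] d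

/-- The ideal `Ann_R(ℰ(C) + ℱ(C'))` defining the member of `H₁(a, b, c, i, s)` with parameters
`C` (coefficients of `s` forms in the span of the monomials in `ℳ_P(j)`) and
`C'` (coefficients of one form in the span of the monomials in `ℳ_Q(j)`), `j = i + abc`. -/
def H1Ideal {k : Type*} [Field k] (a b c i s : ℕ)
    (C : Fin s × H1P a b c (i + a * b * c) → k)
    (C' : Fin 1 × H1Q (i + a * b * c) (i + a * b * c) → k) : Ideal (MvPolynomial (Fin 5) k) :=
  annIdeal (spanOf (H1P a b c (i + a * b * c)) s C +
    spanOf (H1Q (i + a * b * c) (i + a * b * c)) 1 C')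

/-- The parameters `(a, b, c, i, s)` are permissible. -/
structure H1Params (a b c i s : ℕ) : Prop where
  two_le_a : 2 ≤ a
  a_le_b : a ≤ b
  b_le_c : b ≤ c
  le_i : a * b * c ≤ i
  s_pos : 0 < s
  /-- With `j = i + abc` and `i_f = i + 3`, the matrix of partial derivatives of order `j - i_f` of
  `f_1, …, f_s`, with rows indexed by `ℳ_P(j - i_f) × {1, …, s}` and columns indexed by
  `ℳ_P(i_f)`, has at least as many rows as columns. -/
  sufficient : (H1P a b c (i + 3)).card ≤ (H1P a b c (i + a * b * c - (i + 3)) ×ˢ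
    (Finset.univ : Finset (Fin s))).card

/-- For general `C` and general `C'`, the member of `H₁(a, b, c, i, s)` with parameters `C`, `C'`
is a level algebra of codimension `5`, socle degree `j = i + abc` and type `t`. -/
def H1HasType (k : Type*) [Field k] (a b c i s t : ℕ) : Prop :=
  ∃ U : Set (Fin s × H1P a b c (i + a * b * c) → k),
  ∃ U' : Set (Fin 1 × H1Q (i + a * b * c) (i + a * b * c) → k),
    IsDenseZariskiOpen U ∧ IsDenseZariskiOpen U' ∧
    ∀ C ∈ U, ∀ C' ∈ U', IsLevelOfType (H1Ideal a b c i s C C') (i + a * b * c) t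

/-- `ceil((2i - a - b - c + 11) / (2abc - a - b - c - 1))`. -/
def H1s (a b c i : ℕ) : ℕ :=
  ⌈(2 * i - a - b - c + 11 : ℚ) / (2 * (a * b * c) - a - b - c - 1)⌉₊

end H1

end LevelAlg

end

/-! By Macaulay duality in characteristic 0, a nonzero space of forms of degree `j` killed by no
nonzero linear form defines a level algebra whose type is the dimension of the space
(`isLevelOfType_annIdeal`). For general coefficients the `s` forms span a space of dimension `min s
m_P(j)` and already exclude linear annihilators. The extra form in `x₁, x₂, x₃` shares no monomial
with them, so the general type is `1 + min s m_P(j)` (`h1HasType_min`); the inequality in the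
definition of permissibility plays no role here.

What remains is counting. For `d ≥ a + b + c - 4` one has `2 m_P(d) = abc (2d + 5 - a - b - c)`, so
after cancelling `abc` permissibility becomes `s ≥ s₀(i)` (`h1Params_iff`). As `s₀(i) ≤ m_P(j)`, the
smallest type for fixed `i` is `1 + s₀(i)`. It increases weakly with `i`, so `i = abc` is optimal;
there the quotient under the ceiling is `1 + 12 / (2abc - a - b - c - 1)`, which exceeds 1, and
exceeds 2 only for `(2, 2, 2)`. -/

namespace LevelAlg

/-! ### The coefficients of `F * f` -/

section Coefficients

variable {k : Type*} [Field k] {r : ℕ}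

/-- The integer factor by which `∂^E` multiplies the coefficient of `x^(m+E)` when it sends that
monomial to a multiple of `x^m`. -/
def diffFactor (m E : Fin r →₀ ℕ) : ℕ :=
  ∏ i, (m i + E i).descFactorial (E i)

theorem diffFactor_ne_zero (m E : Fin r →₀ ℕ) : diffFactor m E ≠ 0 := by
  refine Finset.prod_ne_zero_iff.mpr fun i _ => ?_
  rw [Ne, Nat.descFactorial_eq_zero_iff_lt]
  omega

theorem diffFactor_add_single (m E : Fin r →₀ ℕ) (i : Fin r) :
    diffFactor m (E + Finsupp.single i 1) =
      (m i + 1) * diffFactor (m + Finsupp.single i 1) E := by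
  unfold diffFactor
  rw [← Finset.mul_prod_erase Finset.univ _ (Finset.mem_univ i),
    ← Finset.mul_prod_erase Finset.univ _ (Finset.mem_univ i), ← mul_assoc]
  congr 1
  · simp only [Finsupp.add_apply, Finsupp.single_eq_same]
    rw [show m i + (E i + 1) = m i + 1 + E i by ring, Nat.descFactorial_succ]
    congr 1
    omega
  · refine Finset.prod_congr rfl fun l hl => ?_
    simp [Finsupp.single_eq_of_ne (Finset.ne_of_mem_erase hl)]

theorem partialMon_zero : partialMon (k := k) (0 : Fin r →₀ ℕ) = 1 := by
  refine (Finset.noncommProd_eq_pow_card _ _ _ 1 fun l _ => ?_).trans (one_pow _)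
  simp

theorem coeff_partialMon (E m : Fin r →₀ ℕ) (f : MvPolynomial (Fin r) k) :
    coeff m (partialMon E f) = diffFactor m E * coeff (m + E) f := by
  obtain ⟨n, hn⟩ : ∃ n, E.degree = n := ⟨_, rfl⟩
  induction n generalizing E m with
  | zero =>
    obtain rfl : E = 0 := (Finsupp.degree_eq_zero_iff E).mp hn
    simp [partialMon_zero, diffFactor]
  | succ n ih =>
    obtain ⟨i, hi⟩ : ∃ i, E i ≠ 0 := by
      by_contra! h
      obtain rfl : E = 0 := Finsupp.ext h
      simp at hn
    obtain ⟨D, rfl⟩ : ∃ D, E = D + Finsupp.single i 1 :=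
      ⟨E - Finsupp.single i 1, (tsub_add_cancel_of_le (by
        rw [Finsupp.single_le_iff]; omega)).symm⟩
    have hD : D.degree = n := by simpa using hn
    rw [show partialMon (k := k) (D + Finsupp.single i 1) = partialMon (Finsupp.single i 1 + D) by
      rw [add_comm], partialMon_add, Module.End.mul_apply, partialMon_single]
    change coeff m (pderiv i _) = _
    rw [coeff_pderiv, ih _ _ hD, diffFactor_add_single, ← add_assoc,
      add_right_comm m]
    push_cast
    ring

theorem coeff_diffAct (F f : MvPolynomial (Fin r) k) (m : Fin r →₀ ℕ) :
    coeff m (diffAct F f) =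
      ∑ E ∈ F.support, coeff E F * (diffFactor m E * coeff (m + E) f) := by
  conv_lhs => rw [F.as_sum]
  simp only [map_sum, LinearMap.sum_apply, coeff_sum, diffAct_monomial, LinearMap.smul_apply,
    coeff_smul, coeff_partialMon, smul_eq_mul]

/-- Degree bookkeeping: the degree `d` part of `F` sends a form of degree `j` into degree `j - d`,
so the graded parts of `F * f` separate the components of `F`. -/
theorem coeff_diffAct_homogeneousComponent {j : ℕ} {f : MvPolynomial (Fin r) k}
    (hf : f.IsHomogeneous j) (F : MvPolynomial (Fin r) k) (d : ℕ) (m : Fin r →₀ ℕ) :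
    coeff m (diffAct (homogeneousComponent d F) f) =
      if m.degree + d = j then coeff m (diffAct F f) else 0 := by
  have key : ∀ E, coeff E (homogeneousComponent d F) * (diffFactor m E * coeff (m + E) f) =
      if m.degree + d = j then coeff E F * (diffFactor m E * coeff (m + E) f) else 0 := by
    intro E
    by_cases h : coeff (m + E) f = 0
    · simp [h]
    · have hE : m.degree + E.degree = j := by
        by_contra hne
        exact h (hf.coeff_eq_zero (by rwa [map_add]))
      rw [coeff_homogeneousComponent]
      have : E.degree = d ↔ m.degree + d = j := by omega
      simp only [this]
      split_ifs <;> simp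
  have hsub : (homogeneousComponent d F).support ⊆ F.support := by
    intro E hE
    rw [mem_support_iff, coeff_homogeneousComponent] at hE
    rw [mem_support_iff]
    intro h
    simp [h] at hE
  rw [coeff_diffAct, coeff_diffAct, Finset.sum_subset hsub, Finset.sum_congr rfl fun E _ => key E]
  · split_ifs <;> simp
  · intro E _ hE
    rw [notMem_support_iff.mp hE, zero_mul]

theorem diffAct_homogeneousComponent_eq_zero {j : ℕ} {f F : MvPolynomial (Fin r) k}
    (hf : f.IsHomogeneous j) (h : diffAct F f = 0) (d : ℕ) :
    diffAct (homogeneousComponent d F) f = 0 := by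
  ext m
  rw [coeff_diffAct_homogeneousComponent hf, h]
  simp

theorem diffAct_eq_zero_of_lt {j d : ℕ} {f F : MvPolynomial (Fin r) k} (hf : f.IsHomogeneous j)
    (hF : F.IsHomogeneous d) (hd : j < d) : diffAct F f = 0 := by
  ext m
  rw [← (homogeneousComponent_of_mem hF : homogeneousComponent d F = _).trans (if_pos rfl),
    coeff_diffAct_homogeneousComponent hf, if_neg (by omega), coeff_zero]

/-- A polynomial `F` all of whose products with variables kill the form `f` of degree `j` acts on
`f` as its component of degree `j` does. -/
theorem diffAct_homogeneousComponent_of_X_mul [CharZero k] {j : ℕ} {f F : MvPolynomial (Fin r) k}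
    (hf : f.IsHomogeneous j) (h : ∀ i, diffAct (X i * F) f = 0) :
    diffAct (homogeneousComponent j F) f = diffAct F f := by
  ext m
  rw [coeff_diffAct_homogeneousComponent hf]
  split_ifs with hm
  · rfl
  · obtain ⟨i, hi⟩ : ∃ i, m i ≠ 0 := by
      by_contra! h0
      obtain rfl : m = 0 := Finsupp.ext h0
      simp at hm
    -- All partials of `F * f` vanish; this coefficient of `∂_i (F * f)` is `m i` times the
    -- coefficient of `x^m`, and `m i ≠ 0` in `k`.
    have h1 := congrArg (coeff (m - Finsupp.single i 1)) (h i)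
    rw [diffAct_mul, Module.End.mul_apply, diffAct_X, coeff_pderiv, tsub_add_cancel_of_le (by
      rw [Finsupp.single_le_iff]; omega), coeff_zero] at h1
    exact ((mul_eq_zero.mp h1).resolve_right (Nat.cast_add_one_ne_zero _)).symm

theorem diffAct_isHomogeneous_eq_C {j : ℕ} {f F : MvPolynomial (Fin r) k}
    (hf : f.IsHomogeneous j) (hF : F.IsHomogeneous j) :
    diffAct F f = C (coeff 0 (diffAct F f)) := by
  ext m
  rw [coeff_C]
  split_ifs with hm
  · rw [hm]
  · rw [← (homogeneousComponent_of_mem hF : homogeneousComponent j F = _).trans (if_pos rfl),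
      coeff_diffAct_homogeneousComponent hf, if_neg]
    intro h
    exact hm ((Finsupp.degree_eq_zero_iff m).mp (by omega)).symm

end Coefficients

/-! ### Level algebras from inverse systems -/

section InverseSystem

variable {k : Type*} [Field k] {r j : ℕ} {W : Submodule k (MvPolynomial (Fin r) k)}

theorem mem_annIdeal {F : MvPolynomial (Fin r) k} :
    F ∈ annIdeal W ↔ ∀ f ∈ W, diffAct F f = 0 := Iff.rfl

/-- The pairing `R_j × 𝒲 → k`, `(F, f) ↦ (F * f)(0)`. -/
noncomputable def inversePairing (j : ℕ) (W : Submodule k (MvPolynomial (Fin r) k)) :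
    homogeneousSubmodule (Fin r) k j →ₗ[k] W →ₗ[k] k :=
  LinearMap.mk₂ k (fun F f => coeff 0 (diffAct (F : MvPolynomial (Fin r) k) f))
    (by simp) (by simp) (by simp) (by simp)

theorem inversePairing_apply (F : homogeneousSubmodule (Fin r) k j) (f : W) :
    inversePairing j W F f = coeff 0 (diffAct (F : MvPolynomial (Fin r) k) f) := rfl

/-- Pairing `f` with `X^m` gives `m!` times its coefficient at `x^m`, and `m!` is invertible in
characteristic 0. -/
theorem inversePairing_flip_injective [CharZero k] (hW : W ≤ homogeneousSubmodule (Fin r) k j) :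
    Function.Injective (inversePairing j W).flip := by
  rw [injective_iff_map_eq_zero]
  intro f hf
  ext m
  rw [ZeroMemClass.coe_zero, coeff_zero]
  by_cases hm : m.degree = j
  · have h := LinearMap.congr_fun hf ⟨monomial m 1, isHomogeneous_monomial 1 hm⟩
    rw [LinearMap.flip_apply, inversePairing_apply, diffAct_monomial, one_smul, coeff_partialMon,
      zero_add, LinearMap.zero_apply] at h
    exact (mul_eq_zero.mp h).resolve_left (Nat.cast_ne_zero.mpr (diffFactor_ne_zero _ _))
  · exact IsHomogeneous.coeff_eq_zero (hW f.2) hm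

/-- The pairing maps `R_j` onto the dual of `W`, with kernel the degree `j` part of the annihilator:
in equal degrees `F * f` is constant, so it vanishes once its value at 0 does. -/
theorem finrank_gradedPiece_annIdeal [CharZero k] [FiniteDimensional k W]
    (hW : W ≤ homogeneousSubmodule (Fin r) k j) :
    Module.finrank k (gradedPiece (annIdeal W) j) = Module.finrank k W := by
  have hsurj : Function.Surjective (inversePairing j W) :=
    LinearMap.flip_injective_iff₂.mp (inversePairing_flip_injective hW)
  set ψ := (Ideal.Quotient.mkₐ k (annIdeal W)).toLinearMap.domRestrict
    (homogeneousSubmodule (Fin r) k j) with hψ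
  have hker : LinearMap.ker ψ = LinearMap.ker (inversePairing j W) := by
    ext F
    rw [LinearMap.mem_ker, LinearMap.mem_ker, hψ, LinearMap.domRestrict_apply]
    change Ideal.Quotient.mk _ _ = 0 ↔ _
    rw [Ideal.Quotient.eq_zero_iff_mem, mem_annIdeal]
    constructor
    · intro h
      ext f
      rw [inversePairing_apply, h f f.2]
      simp
    · intro h f hf
      have h1 : coeff 0 (diffAct (F : MvPolynomial (Fin r) k) f) = 0 :=
        LinearMap.congr_fun h ⟨f, hf⟩
      rw [diffAct_isHomogeneous_eq_C (hW hf) F.2, h1, C_0]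
  have hrange : gradedPiece (annIdeal W) j = LinearMap.range ψ := by
    rw [hψ, LinearMap.range_domRestrict]
    rfl
  rw [hrange, ← (LinearMap.quotKerEquivRange ψ).finrank_eq, hker,
    ((inversePairing j W).quotKerEquivOfSurjective hsurj).finrank_eq]
  exact Subspace.dual_finrank_eq

theorem gradedPiece_annIdeal_eq_bot (hW : W ≤ homogeneousSubmodule (Fin r) k j) {d : ℕ}
    (hd : j < d) : gradedPiece (annIdeal W) d = ⊥ := by
  rw [eq_bot_iff]
  rintro _ ⟨F, hF, rfl⟩
  refine Ideal.Quotient.eq_zero_iff_mem.mpr fun f hf => ?_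
  exact diffAct_eq_zero_of_lt (hW hf) hF hd

theorem finite_quotient_annIdeal (hW : W ≤ homogeneousSubmodule (Fin r) k j) :
    Module.Finite k (MvPolynomial (Fin r) k ⧸ annIdeal W) := by
  set q := (Ideal.Quotient.mkₐ k (annIdeal W)).toLinearMap with hq
  set S : Set (MvPolynomial (Fin r) k) :=
    (fun D => monomial D (1 : k)) '' {D : Fin r →₀ ℕ | D.degree ≤ j} with hS
  have hfin : (q '' S).Finite := ((Finsupp.finite_of_degree_le j).image _).image _
  refine ⟨(Submodule.fg_def).mpr ⟨_, hfin, ?_⟩⟩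
  rw [eq_top_iff]
  rintro x -
  obtain ⟨F, rfl⟩ := Ideal.Quotient.mk_surjective x
  change q F ∈ _
  rw [F.as_sum, map_sum]
  refine Submodule.sum_mem _ fun D _ => ?_
  have : monomial D (coeff D F) = coeff D F • monomial D (1 : k) := by simp [smul_monomial]
  rw [this, map_smul]
  refine Submodule.smul_mem _ _ ?_
  by_cases hD : D.degree ≤ j
  · exact Submodule.subset_span ⟨_, ⟨D, hD, rfl⟩, rfl⟩
  · have h0 : q (monomial D (1 : k)) = 0 := by
      refine Ideal.Quotient.eq_zero_iff_mem.mpr fun f hf => ?_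
      exact diffAct_eq_zero_of_lt (hW hf) (isHomogeneous_monomial (1 : k) rfl) (not_le.mp hD)
    rw [h0]
    exact Submodule.zero_mem _

theorem X_mem_gradedPiece (I : Ideal (MvPolynomial (Fin r) k)) (i : Fin r) :
    Ideal.Quotient.mk I (X i) ∈ gradedPiece I 1 :=
  ⟨X i, isHomogeneous_X k i, rfl⟩

/-- If every `X_i F` kills `W`, then `F` maps `W` to constants, so it acts on `W` as its degree `j`
component. The other inclusion is by degree. -/
theorem socle_annIdeal [CharZero k] (hW : W ≤ homogeneousSubmodule (Fin r) k j) :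
    socle (annIdeal W) =
      (gradedPiece (annIdeal W) j : Set (MvPolynomial (Fin r) k ⧸ annIdeal W)) := by
  ext x
  constructor
  · intro hx
    obtain ⟨F, rfl⟩ := Ideal.Quotient.mk_surjective x
    refine ⟨homogeneousComponent j F, homogeneousComponent_isHomogeneous j F, ?_⟩
    refine Ideal.Quotient.eq.mpr fun f hf => ?_
    rw [map_sub, LinearMap.sub_apply, sub_eq_zero]
    refine diffAct_homogeneousComponent_of_X_mul (hW hf) fun i => ?_
    have h := hx _ (X_mem_gradedPiece _ i)
    rw [← map_mul, Ideal.Quotient.eq_zero_iff_mem, mul_comm] at h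
    exact h f hf
  · rintro ⟨F, hF, rfl⟩ _ ⟨L, hL, rfl⟩
    change Ideal.Quotient.mk _ F * Ideal.Quotient.mk _ L = 0
    rw [← map_mul, Ideal.Quotient.eq_zero_iff_mem]
    intro f hf
    exact diffAct_eq_zero_of_lt (hW hf) (IsHomogeneous.mul hF hL) (Nat.lt_succ_self j)

/-- Macaulay's inverse systems, in one degree: a nonzero space `𝒲` of forms of degree `j` that is
not killed by a nonzero linear form defines a level algebra of socle degree `j` and type
`dim 𝒲`. -/
theorem isLevelOfType_annIdeal [CharZero k] [FiniteDimensional k W]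
    (hW : W ≤ homogeneousSubmodule (Fin r) k j) (hW0 : W ≠ ⊥)
    (hlin : ∀ l : Fin r → k, (∀ f ∈ W, ∑ i, l i • pderiv i f = 0) → l = 0) :
    IsLevelOfType (annIdeal W) j (Module.finrank k W) where
  homogeneous F hF d f hf := diffAct_homogeneousComponent_eq_zero (hW hf) (hF f hf) d
  codim d hd F hF hFd := by
    obtain rfl | rfl : d = 0 ∨ d = 1 := by omega
    · obtain ⟨f, hf, hf0⟩ := (Submodule.ne_bot_iff W).mp hW0
      have hC : F = C (coeff 0 F) := by
        rw [← totalDegree_eq_zero_iff_eq_C]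
        simpa using hFd.totalDegree_le
      have h := hF f hf
      rw [hC, ← monomial_zero', diffAct_monomial, partialMon_zero, LinearMap.smul_apply,
        Module.End.one_apply, smul_eq_zero] at h
      rw [hC, h.resolve_right hf0, C_0]
    · have hsum : F = ∑ i, coeff (Finsupp.single i 1) F • X i := by
        ext m
        simp only [coeff_sum, coeff_smul, coeff_X, smul_eq_mul, mul_ite, mul_one, mul_zero]
        by_cases hm : m.degree = 1
        · obtain ⟨i, rfl⟩ : ∃ i, m = Finsupp.single i 1 := by
            obtain ⟨i, hi⟩ : ∃ i, m i ≠ 0 := by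
              by_contra! h0
              obtain rfl : m = 0 := Finsupp.ext h0
              simp at hm
            have hle : Finsupp.single i 1 ≤ m := by rw [Finsupp.single_le_iff]; omega
            have hd := congrArg Finsupp.degree (tsub_add_cancel_of_le hle)
            rw [map_add, Finsupp.degree_single] at hd
            have h0 := (Finsupp.degree_eq_zero_iff (m - Finsupp.single i 1)).mp (by omega)
            exact ⟨i, le_antisymm (tsub_eq_zero_iff_le.mp h0) hle⟩
          rw [Finset.sum_eq_single i]
          · simp
          · intro l _ hl
            rw [if_neg]
            intro h
            exact hl (Finsupp.single_left_injective one_ne_zero h)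
          · simp
        · rw [hFd.coeff_eq_zero hm, Finset.sum_eq_zero]
          intro i _
          rw [if_neg]
          rintro rfl
          simp at hm
      have hl : (fun i => coeff (Finsupp.single i 1) F) = 0 := by
        refine hlin _ fun f hf => ?_
        have h := hF f hf
        rw [hsum, map_sum, LinearMap.sum_apply] at h
        simpa only [map_smul, LinearMap.smul_apply, diffAct_X] using h
      rw [hsum]
      refine Finset.sum_eq_zero fun i _ => ?_
      rw [congrFun hl i, Pi.zero_apply, zero_smul]
  artinian := finite_quotient_annIdeal hW
  top_ne_bot h := by
    have h1 := finrank_gradedPiece_annIdeal hW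
    rw [h, finrank_bot] at h1
    exact hW0 (Submodule.finrank_eq_zero.mp h1.symm)
  above_top d hd := gradedPiece_annIdeal_eq_bot hW hd
  level := socle_annIdeal hW
  type_eq := finrank_gradedPiece_annIdeal hW

end InverseSystem

/-! ### Zariski-dense open sets -/

section Zariski

variable {k : Type*} [Field k] {ι : Type*}

/-- Over an infinite field a product of two nonzero polynomials is nonzero at some point. -/
theorem isDenseZariskiOpen_of_ne_zero [Infinite k] {p : MvPolynomial ι k} (hp : p ≠ 0) :
    IsDenseZariskiOpen {x : ι → k | eval x p ≠ 0} := by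
  refine ⟨⟨{p}, by ext; simp⟩, ?_⟩
  rintro _ ⟨S, rfl⟩ ⟨x, hx⟩
  simp only [Set.mem_compl_iff, Set.mem_ofPred_eq, not_forall] at hx
  obtain ⟨q, hqS, hq⟩ := hx
  have hpq : p * q ≠ 0 := mul_ne_zero hp (by rintro rfl; simp at hq)
  obtain ⟨y, hy⟩ : ∃ y, eval y (p * q) ≠ 0 := by
    by_contra! h
    exact hpq (MvPolynomial.funext fun y => by rw [h y, map_zero])
  rw [map_mul] at hy
  exact ⟨y, left_ne_zero_of_mul hy, fun h => right_ne_zero_of_mul hy (h q hqS)⟩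

theorem isZariskiOpen_univ : IsZariskiOpen (Set.univ : Set (ι → k)) :=
  ⟨{1}, by ext; simp⟩

theorem IsDenseZariskiOpen.inter_nonempty {U V : Set (ι → k)} (hU : IsDenseZariskiOpen U)
    (hV : IsDenseZariskiOpen V) : (U ∩ V).Nonempty := by
  refine hU.2 V hV.1 ?_
  obtain ⟨x, hx, -⟩ := hV.2 Set.univ isZariskiOpen_univ ⟨0, trivial⟩
  exact ⟨x, hx⟩

end Zariski

/-! ### Dimensions of general members of the families -/

section Family

variable {k : Type*} [Field k] {r : ℕ}

theorem coeff_formOf (M : Finset (Fin r →₀ ℕ)) (c : M → k) (D : Fin r →₀ ℕ) :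
    coeff D (formOf M c) = if h : D ∈ M then c ⟨D, h⟩ else 0 := by
  unfold formOf
  simp only [coeff_sum, coeff_monomial]
  split_ifs with h
  · rw [Finset.sum_eq_single ⟨D, h⟩]
    · simp
    · rintro ⟨E, hE⟩ _ hne
      rw [if_neg]
      rintro rfl
      exact hne rfl
    · simp
  · refine Finset.sum_eq_zero fun E _ => if_neg ?_
    rintro rfl
    exact h E.2

/-- The coefficient vector of a form in `𝒲_ℳ` determines it linearly. -/
noncomputable def formOfLinear (k : Type*) [Field k] (M : Finset (Fin r →₀ ℕ)) :
    (M → k) →ₗ[k] MvPolynomial (Fin r) k where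
  toFun := formOf M
  map_add' c d := by
    ext D
    simp only [coeff_formOf, coeff_add]
    split_ifs <;> simp
  map_smul' a c := by
    ext D
    simp only [coeff_formOf, coeff_smul, RingHom.id_apply]
    split_ifs <;> simp

theorem formOfLinear_injective (M : Finset (Fin r →₀ ℕ)) :
    Function.Injective (formOfLinear k M) := by
  intro c d h
  funext ⟨D, hD⟩
  have h1 : coeff D (formOf M c) = coeff D (formOf M d) := congrArg (coeff D) h
  simpa [coeff_formOf, hD] using h1

/-- Turns dimensions of spans of forms into ranks of coefficient matrices. -/
theorem spanOf_eq_map (M : Finset (Fin r →₀ ℕ)) (s : ℕ) (C : Fin s × M → k) :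
    spanOf M s C = (Submodule.span k (Set.range (Matrix.of fun m J => C (m, J)).row)).map
      (formOfLinear k M) := by
  rw [Submodule.map_span, ← Set.range_comp]
  rfl

instance finiteDimensional_spanOf (M : Finset (Fin r →₀ ℕ)) (s : ℕ) (C : Fin s × M → k) :
    FiniteDimensional k (spanOf M s C) :=
  FiniteDimensional.span_of_finite k (Set.finite_range _)

theorem finrank_spanOf (M : Finset (Fin r →₀ ℕ)) (s : ℕ) (C : Fin s × M → k) :
    Module.finrank k (spanOf M s C) = (Matrix.of fun m J => C (m, J)).rank := by
  rw [Matrix.rank_eq_finrank_span_row, spanOf_eq_map]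
  exact (Submodule.equivMapOfInjective _ (formOfLinear_injective M) _).finrank_eq.symm

theorem coeff_eq_zero_of_mem_spanOf {M : Finset (Fin r →₀ ℕ)} {s : ℕ} {C : Fin s × M → k}
    {f : MvPolynomial (Fin r) k} (hf : f ∈ spanOf M s C) {D : Fin r →₀ ℕ} (hD : D ∉ M) :
    coeff D f = 0 := by
  rw [spanOf_eq_map] at hf
  obtain ⟨c, -, rfl⟩ := hf
  exact (coeff_formOf M c D).trans (dif_neg hD)

theorem formOf_mem_spanOf (M : Finset (Fin r →₀ ℕ)) {s : ℕ} (C : Fin s × M → k) (m : Fin s) :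
    formOf M (fun J => C (m, J)) ∈ spanOf M s C :=
  Submodule.subset_span ⟨m, rfl⟩

theorem spanOf_le_homogeneousSubmodule {M : Finset (Fin r →₀ ℕ)} {s j : ℕ}
    (hM : ∀ D ∈ M, D.degree = j) (C : Fin s × M → k) :
    spanOf M s C ≤ homogeneousSubmodule (Fin r) k j := by
  intro f hf
  rw [mem_homogeneousSubmodule]
  intro D hD
  rw [← hM D (by_contra fun h => hD (coeff_eq_zero_of_mem_spanOf hf h)),
    Finsupp.degree_eq_weight_one]
  rfl

theorem spanOf_inf_eq_bot {M M' : Finset (Fin r →₀ ℕ)} (hM : Disjoint M M') {s s' : ℕ}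
    (C : Fin s × M → k) (C' : Fin s' × M' → k) : spanOf M s C ⊓ spanOf M' s' C' = ⊥ := by
  rw [eq_bot_iff]
  rintro f ⟨hf, hf'⟩
  refine (Submodule.mem_bot k).mpr (MvPolynomial.ext _ _ fun D => ?_)
  rw [coeff_zero]
  by_cases hD : D ∈ M
  · exact coeff_eq_zero_of_mem_spanOf hf' (Finset.disjoint_left.mp hM hD)
  · exact coeff_eq_zero_of_mem_spanOf hf hD

/-- The span of `s` general forms in `𝒲_ℳ` has the dimension it should have. -/
theorem exists_finrank_spanOf_eq_min (k : Type*) [Field k] (M : Finset (Fin r →₀ ℕ)) (s : ℕ) :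
    ∃ p : MvPolynomial (Fin s × M) k, p ≠ 0 ∧
      ∀ C, eval C p ≠ 0 → Module.finrank k (spanOf M s C) = min s M.card := by
  set n := min s M.card with hn
  let u : Fin n ↪ Fin s := Fin.castLEEmb (min_le_left _ _)
  let v : Fin n ↪ M := (Fin.castLEEmb (min_le_right s M.card)).trans M.equivFin.symm.toEmbedding
  have huv : Function.Injective (Prod.map u v) := u.injective.prodMap v.injective
  -- The open condition is that one chosen maximal minor of the coefficient matrix does not vanish.
  refine ⟨rename (Prod.map u v) (Matrix.mvPolynomialX (Fin n) (Fin n) k).det, ?_, ?_⟩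
  · rw [Ne, map_eq_zero_iff _ (rename_injective _ huv)]
    exact Matrix.det_mvPolynomialX_ne_zero _ _
  · intro C hC
    rw [finrank_spanOf]
    set A : Matrix (Fin s) M k := Matrix.of fun m J => C (m, J) with hA
    refine le_antisymm (le_min ?_ ?_) ?_
    · simpa using A.rank_le_card_height
    · simpa using A.rank_le_card_width
    · have hdet : (A.submatrix u v).det ≠ 0 := by
        rw [eval_rename, RingHom.map_det] at hC
        convert hC using 2
        ext x y
        simp [hA, Matrix.mvPolynomialX]
      have h := A.rank_submatrix_le u v
      rwa [Matrix.rank_of_det_ne_zero hdet, Fintype.card_fin] at h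

end Family

/-! ### The general member of `H₁` -/

section GeneralMember

variable {k : Type*} [Field k]

/-- The multi-index with the given entries. -/
noncomputable def multiIdx5 (x y z u v : ℕ) : Fin 5 →₀ ℕ :=
  Finsupp.equivFunOnFinite.symm ![x, y, z, u, v]

theorem mem_H1P {a b c d : ℕ} {D : Fin 5 →₀ ℕ} :
    D ∈ H1P a b c d ↔ D.degree = d ∧ D 0 ≤ a - 1 ∧ D 1 ≤ b - 1 ∧ D 2 ≤ c - 1 := by
  simp [H1P, multiIdx, Fin.forall_fin_succ, Finsupp.degree_eq_sum]

theorem mem_H1Q {j d : ℕ} {D : Fin 5 →₀ ℕ} :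
    D ∈ H1Q j d ↔ D.degree = d ∧ D 0 ≤ j ∧ D 1 ≤ j ∧ D 2 ≤ j ∧ D 3 = 0 ∧ D 4 = 0 := by
  simp [H1Q, multiIdx, Fin.forall_fin_succ, Finsupp.degree_eq_sum]

theorem degree_multiIdx5 (x y z u v : ℕ) :
    (multiIdx5 x y z u v).degree = x + y + z + u + v := by
  simp [multiIdx5, Finsupp.degree_eq_sum, Fin.sum_univ_five]

theorem multiIdx5_mem_H1P {a b c d x y z u v : ℕ} :
    multiIdx5 x y z u v ∈ H1P a b c d ↔
      x + y + z + u + v = d ∧ x ≤ a - 1 ∧ y ≤ b - 1 ∧ z ≤ c - 1 := by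
  rw [mem_H1P, degree_multiIdx5]
  rfl

theorem multiIdx5_inj {x y z u v x' y' z' u' v' : ℕ} :
    multiIdx5 x y z u v = multiIdx5 x' y' z' u' v' ↔
      x = x' ∧ y = y' ∧ z = z' ∧ u = u' ∧ v = v' := by
  simp [multiIdx5]

theorem eq_multiIdx5 (D : Fin 5 →₀ ℕ) : D = multiIdx5 (D 0) (D 1) (D 2) (D 3) (D 4) := by
  ext i
  fin_cases i <;> rfl

theorem coeff_sum_smul_pderiv (f : MvPolynomial (Fin 5) k) (l : Fin 5 → k) (x y z u v : ℕ) :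
    coeff (multiIdx5 x y z u v) (∑ i, l i • pderiv i f) =
      l 0 * (coeff (multiIdx5 (x + 1) y z u v) f * (x + 1)) +
      l 1 * (coeff (multiIdx5 x (y + 1) z u v) f * (y + 1)) +
      l 2 * (coeff (multiIdx5 x y (z + 1) u v) f * (z + 1)) +
      l 3 * (coeff (multiIdx5 x y z (u + 1) v) f * (u + 1)) +
      l 4 * (coeff (multiIdx5 x y z u (v + 1)) f * (v + 1)) := by
  have h (i : Fin 5) : multiIdx5 x y z u v + Finsupp.single i 1 =
      ![multiIdx5 (x + 1) y z u v, multiIdx5 x (y + 1) z u v, multiIdx5 x y (z + 1) u v,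
        multiIdx5 x y z (u + 1) v, multiIdx5 x y z u (v + 1)] i := by
    ext m
    fin_cases i <;> fin_cases m <;> simp [multiIdx5]
  rw [coeff_sum, Fin.sum_univ_five]
  simp only [coeff_smul, coeff_pderiv, h, smul_eq_mul]
  rfl

/-- A condition on four coefficients under which the partial derivatives of a form with
constrained exponents are linearly independent. -/
theorem eq_zero_of_sum_smul_pderiv_eq_zero [CharZero k] {A B G N : ℕ}
    {f : MvPolynomial (Fin 5) k}
    (hf : ∀ D, coeff D f ≠ 0 → D 0 ≤ A + 1 ∧ D 1 ≤ B + 1 ∧ D 2 ≤ G + 1)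
    (h0 : coeff (multiIdx5 (A + 1) (B + 1) (G + 1) 0 (N + 1)) f ≠ 0)
    (hdet : coeff (multiIdx5 (A + 1) (B + 1) (G + 1) 1 N) f *
        coeff (multiIdx5 (A + 1) (B + 1) (G + 1) N 1) f -
      (N + 1) ^ 2 * (coeff (multiIdx5 (A + 1) (B + 1) (G + 1) 0 (N + 1)) f *
        coeff (multiIdx5 (A + 1) (B + 1) (G + 1) (N + 1) 0) f) ≠ 0)
    {l : Fin 5 → k} (hl : ∑ i, l i • pderiv i f = 0) : l = 0 := by
  have hx (y z u v : ℕ) : coeff (multiIdx5 (A + 1 + 1) y z u v) f = 0 := by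
    by_contra h
    have h1 : A + 1 + 1 ≤ A + 1 := (hf _ h).1
    omega
  have hy (x z u v : ℕ) : coeff (multiIdx5 x (B + 1 + 1) z u v) f = 0 := by
    by_contra h
    have h1 : B + 1 + 1 ≤ B + 1 := (hf _ h).2.1
    omega
  have hz (x y u v : ℕ) : coeff (multiIdx5 x y (G + 1 + 1) u v) f = 0 := by
    by_contra h
    have h1 : G + 1 + 1 ≤ G + 1 := (hf _ h).2.2
    omega
  have hc (x y z u v : ℕ) := (coeff_sum_smul_pderiv f l x y z u v).symm.trans
    ((congrArg (coeff (multiIdx5 x y z u v)) hl).trans (coeff_zero _))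
  -- With the first three exponents maximal, `∂₁, ∂₂, ∂₃` contribute nothing; two equations in `l 3,
  -- l 4` remain, whose determinant is the quantity in `hdet`.
  have e1 := hc (A + 1) (B + 1) (G + 1) 0 N
  have e2 := hc (A + 1) (B + 1) (G + 1) N 0
  simp only [hx, hy, hz, zero_mul, mul_zero, zero_add, Nat.cast_zero, mul_one] at e1 e2
  have h3 : l 3 = 0 := by
    refine (mul_eq_zero.mp ?_).resolve_right hdet
    linear_combination coeff (multiIdx5 (A + 1) (B + 1) (G + 1) N 1) f * e1 -
      (N + 1) * coeff (multiIdx5 (A + 1) (B + 1) (G + 1) 0 (N + 1)) f * e2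
  have h4 : l 4 = 0 := by
    refine (mul_eq_zero.mp ?_).resolve_right hdet
    linear_combination coeff (multiIdx5 (A + 1) (B + 1) (G + 1) 1 N) f * e2 -
      (N + 1) * coeff (multiIdx5 (A + 1) (B + 1) (G + 1) (N + 1) 0) f * e1
  -- Lowering one of the three maximal exponents by one isolates the corresponding `l i`.
  have ex := hc A (B + 1) (G + 1) 0 (N + 1)
  have ey := hc (A + 1) B (G + 1) 0 (N + 1)
  have ez := hc (A + 1) (B + 1) G 0 (N + 1)
  simp only [hx, hy, hz, h3, h4, zero_mul, mul_zero, zero_add, add_zero] at ex ey ez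
  funext i
  fin_cases i
  · exact (mul_eq_zero.mp ex).resolve_right (mul_ne_zero h0 (Nat.cast_add_one_ne_zero _))
  · exact (mul_eq_zero.mp ey).resolve_right (mul_ne_zero h0 (Nat.cast_add_one_ne_zero _))
  · exact (mul_eq_zero.mp ez).resolve_right (mul_ne_zero h0 (Nat.cast_add_one_ne_zero _))
  · exact h3
  · exact h4

/-- No nonzero linear form kills a general form in the span of `ℳ_P(j)`. -/
theorem exists_pderiv_independent (k : Type*) [Field k] [CharZero k] {a b c j s : ℕ} (ha : 2 ≤ a)
    (hb : 2 ≤ b) (hc : 2 ≤ c) (hj : a + b + c ≤ j + 1) (hs : 0 < s) :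
    ∃ p : MvPolynomial (Fin s × H1P a b c j) k, p ≠ 0 ∧ ∀ C, eval C p ≠ 0 →
      ∀ l : Fin 5 → k, (∀ f ∈ spanOf (H1P a b c j) s C, ∑ i, l i • pderiv i f = 0) → l = 0 := by
  obtain ⟨A, rfl⟩ := Nat.exists_eq_add_of_le' ha
  obtain ⟨B, rfl⟩ := Nat.exists_eq_add_of_le' hb
  obtain ⟨G, rfl⟩ := Nat.exists_eq_add_of_le' hc
  -- Degree at least 2 is left for `x₄, x₅`, so mixed monomials, distinct from the pure powers,
  -- exist.
  obtain ⟨N, rfl⟩ : ∃ N, j = A + 1 + (B + 1) + (G + 1) + (N + 1 + 1) :=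
    ⟨j - (A + B + G + 5), by omega⟩
  set M := H1P (A + 2) (B + 2) (G + 2) (A + 1 + (B + 1) + (G + 1) + (N + 1 + 1)) with hM
  have hmem {u v : ℕ} (h : u + v = N + 1 + 1) :
      multiIdx5 (A + 1) (B + 1) (G + 1) u v ∈ M := by
    rw [hM, multiIdx5_mem_H1P]
    omega
  let J (u v : ℕ) (h : u + v = N + 1 + 1) : Fin s × M := (⟨0, hs⟩, ⟨_, hmem h⟩)
  have h1 : 1 + (N + 1) = N + 1 + 1 := by omega
  have h2 : 0 + (N + 1 + 1) = N + 1 + 1 := by omega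
  let Y (u v : ℕ) (h : u + v = N + 1 + 1) : MvPolynomial (Fin s × M) k := X (J u v h)
  let q : MvPolynomial (Fin s × M) k := Y 1 (N + 1) h1 * Y (N + 1) 1 rfl -
    C (((N + 1 : ℕ) + 1 : k) ^ 2) * (Y 0 (N + 1 + 1) h2 * Y (N + 1 + 1) 0 rfl)
  refine ⟨Y 0 (N + 1 + 1) h2 * q, mul_ne_zero (X_ne_zero _) ?_, ?_⟩
  · intro h
    -- Setting pure-power coefficients to 0 and mixed ones to 1 gives `q` the value 1.
    let e (y : Fin s × M) : k :=
      if (y.2 : Fin 5 →₀ ℕ) 3 = 0 ∨ (y.2 : Fin 5 →₀ ℕ) 4 = 0 then 0 else 1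
    have h' := congrArg (eval e) h
    simp [q, Y, J, e, multiIdx5] at h'
  · intro c hc l hl
    have hcoef {u v : ℕ} (h : u + v = N + 1 + 1) :
        coeff (multiIdx5 (A + 1) (B + 1) (G + 1) u v) (formOf M fun y => c (⟨0, hs⟩, y)) =
          c (J u v h) :=
      (coeff_formOf _ _ _).trans (dif_pos (hmem h))
    rw [map_mul, eval_X] at hc
    refine eq_zero_of_sum_smul_pderiv_eq_zero (A := A) (B := B) (G := G) (N := N + 1) ?_ ?_ ?_
      (hl _ (formOf_mem_spanOf M c ⟨0, hs⟩))
    · intro D hD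
      rw [coeff_formOf] at hD
      by_cases h : D ∈ M
      · exact (mem_H1P.mp h).2
      · simp [h] at hD
    · rw [hcoef h2]
      exact left_ne_zero_of_mul hc
    · rw [hcoef h1, hcoef h2, hcoef (u := N + 1) (v := 1) rfl, hcoef (u := N + 1 + 1) (v := 0) rfl]
      simpa [q, Y] using right_ne_zero_of_mul hc

theorem add_add_le_mul_mul {a b c : ℕ} (ha : 2 ≤ a) (hb : 2 ≤ b) (hc : 2 ≤ c) :
    a + b + c + 2 ≤ a * b * c := by
  obtain ⟨x, rfl⟩ := Nat.exists_eq_add_of_le' ha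
  obtain ⟨y, rfl⟩ := Nat.exists_eq_add_of_le' hb
  obtain ⟨z, rfl⟩ := Nat.exists_eq_add_of_le' hc
  ring_nf
  omega

theorem H1Q_nonempty (j : ℕ) : (H1Q j j).Nonempty :=
  ⟨Finsupp.single 0 j, mem_H1Q.mpr (by simp)⟩

/-- A common monomial would have degree at most `a + b + c - 3`. -/
theorem disjoint_H1P_H1Q {a b c j : ℕ} (hj : a + b + c ≤ j) (hj0 : 0 < j) :
    Disjoint (H1P a b c j) (H1Q j j) := by
  rw [Finset.disjoint_left]
  intro D hP hQ
  have h1 := mem_H1P.mp hP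
  have h2 := mem_H1Q.mp hQ
  rw [Finsupp.degree_eq_sum, Fin.sum_univ_five] at h1
  omega

/-- `H₁(a, b, c, i, s)` has a type, the one expected from the dimensions. -/
theorem h1HasType_min (k : Type*) [Field k] [CharZero k] {a b c i s : ℕ} (ha : 2 ≤ a)
    (hb : 2 ≤ b) (hc : 2 ≤ c) (hs : 0 < s) :
    H1HasType k a b c i s (1 + min s (H1P a b c (i + a * b * c)).card) := by
  have habc := add_add_le_mul_mul ha hb hc
  unfold H1HasType H1Ideal
  generalize hj : i + a * b * c = j
  obtain ⟨p, hp, hpC⟩ := exists_finrank_spanOf_eq_min k (H1P a b c j) s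
  obtain ⟨q, hq, hqC⟩ := exists_pderiv_independent k ha hb hc (j := j) (by omega) hs
  obtain ⟨p', hp', hpC'⟩ := exists_finrank_spanOf_eq_min k (H1Q j j) 1
  refine ⟨_, _, isDenseZariskiOpen_of_ne_zero (mul_ne_zero hp hq),
    isDenseZariskiOpen_of_ne_zero hp', fun C hC C' hC' => ?_⟩
  rw [Set.mem_ofPred_eq, map_mul] at hC
  have hE := hpC C (left_ne_zero_of_mul hC)
  have hF := hpC' C' hC'
  rw [min_eq_left (Finset.card_pos.mpr (H1Q_nonempty j))] at hF
  have hdim := Submodule.finrank_sup_add_finrank_inf_eq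
    (spanOf (H1P a b c j) s C) (spanOf (H1Q j j) 1 C')
  rw [spanOf_inf_eq_bot (disjoint_H1P_H1Q (by omega) (by omega)), finrank_bot, add_zero, hE, hF,
    add_comm _ 1] at hdim
  rw [Submodule.add_eq_sup, ← hdim]
  refine isLevelOfType_annIdeal (sup_le ?_ ?_) ?_ ?_
  · exact spanOf_le_homogeneousSubmodule (fun D hD => (mem_H1P.mp hD).1) C
  · exact spanOf_le_homogeneousSubmodule (fun D hD => (mem_H1Q.mp hD).1) C'
  · intro h
    rw [h, finrank_bot] at hdim
    omega
  · intro l hl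
    exact hqC C (right_ne_zero_of_mul hC) l fun f hf => hl f (Submodule.mem_sup_left hf)

/-- Dense open sets meet, so both types are read off one common member. -/
theorem H1HasType.unique {a b c i s t t' : ℕ} (h : H1HasType k a b c i s t)
    (h' : H1HasType k a b c i s t') : t = t' := by
  obtain ⟨U, V, hU, hV, H⟩ := h
  obtain ⟨U', V', hU', hV', H'⟩ := h'
  obtain ⟨C, hC, hC'⟩ := hU.inter_nonempty hU'
  obtain ⟨D, hD, hD'⟩ := hV.inter_nonempty hV'
  exact (H C hC D hD).type_eq.symm.trans (H' C hC' D hD').type_eq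

end GeneralMember

/-! ### Counting constrained monomials -/

section Counting

/-- The exponent of `x₄` runs freely over the remaining degree and that of `x₅` is then forced;
truncated subtraction gives 0 when `x + y + z > d`. -/
theorem card_H1P {a b c : ℕ} (ha : 0 < a) (hb : 0 < b) (hc : 0 < c) (d : ℕ) :
    (H1P a b c d).card =
      ∑ x ∈ Finset.range a, ∑ y ∈ Finset.range b, ∑ z ∈ Finset.range c, (d + 1 - (x + y + z)) := by
  have h : (H1P a b c d).card = ((Finset.range a ×ˢ Finset.range b ×ˢ Finset.range c).sigma
      fun p => Finset.range (d + 1 - (p.1 + p.2.1 + p.2.2))).card := by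
    refine Finset.card_bij' (fun D _ => ⟨(D 0, D 1, D 2), D 3⟩)
      (fun p _ => multiIdx5 p.1.1 p.1.2.1 p.1.2.2 p.2
        (d - (p.1.1 + p.1.2.1 + p.1.2.2 + p.2))) ?_ ?_ ?_ ?_
    · intro D hD
      rw [mem_H1P, Finsupp.degree_eq_sum, Fin.sum_univ_five] at hD
      simp only [Finset.mem_sigma, Finset.mem_product, Finset.mem_range]
      omega
    · rintro ⟨⟨x, y, z⟩, u⟩ hp
      simp only [Finset.mem_sigma, Finset.mem_product, Finset.mem_range] at hp
      rw [multiIdx5_mem_H1P]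
      dsimp only
      omega
    · intro D hD
      rw [mem_H1P, Finsupp.degree_eq_sum, Fin.sum_univ_five] at hD
      conv_rhs => rw [eq_multiIdx5 D]
      rw [multiIdx5_inj]
      dsimp only
      omega
    · rintro ⟨⟨x, y, z⟩, u⟩ _
      rfl
  rw [h, Finset.card_sigma, Finset.sum_product]
  simp only [Finset.sum_product, Finset.card_range]

theorem two_mul_sum_range_sub (c : ℕ) (L : ℚ) :
    2 * ∑ z ∈ Finset.range c, (L - z) = c * (2 * L - c + 1) := by
  induction c with
  | zero => simp
  | succ c ih =>
    rw [Finset.sum_range_succ, mul_add, ih]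
    push_cast
    ring

theorem two_mul_sum_range_sum_range_sub (b c : ℕ) (L : ℚ) :
    2 * ∑ y ∈ Finset.range b, ∑ z ∈ Finset.range c, (L - y - z) =
      b * c * (2 * L - b - c + 2) := by
  induction b with
  | zero => simp
  | succ b ih =>
    rw [Finset.sum_range_succ, mul_add, ih, two_mul_sum_range_sub]
    push_cast
    ring

theorem two_mul_sum_range_sum_range_sum_range_sub (a b c : ℕ) (L : ℚ) :
    2 * ∑ x ∈ Finset.range a, ∑ y ∈ Finset.range b, ∑ z ∈ Finset.range c, (L - x - y - z) =
      a * b * c * (2 * L - a - b - c + 3) := by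
  induction a with
  | zero => simp
  | succ a ih =>
    rw [Finset.sum_range_succ, mul_add, ih, two_mul_sum_range_sum_range_sub]
    push_cast
    ring

/-- Since `x + y + z ≤ a + b + c - 3`, the bound `hd` is exactly what makes every truncated
subtraction a true one. -/
theorem two_mul_card_H1P {a b c d : ℕ} (ha : 0 < a) (hb : 0 < b) (hc : 0 < c)
    (hd : a + b + c ≤ d + 4) :
    (2 * (H1P a b c d).card : ℚ) = a * b * c * (2 * d + 5 - a - b - c) := by
  have h := two_mul_sum_range_sum_range_sum_range_sub a b c (d + 1)
  have hcard : ((H1P a b c d).card : ℚ) = ∑ x ∈ Finset.range a, ∑ y ∈ Finset.range b,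
      ∑ z ∈ Finset.range c, ((d + 1 : ℚ) - x - y - z) := by
    rw [card_H1P ha hb hc]
    push_cast
    refine Finset.sum_congr rfl fun x hx => Finset.sum_congr rfl fun y hy =>
      Finset.sum_congr rfl fun z hz => ?_
    rw [Finset.mem_range] at hx hy hz
    rw [Nat.cast_sub (by omega)]
    push_cast
    ring
  rw [hcard, h]
  ring

theorem card_H1P_mono {a b c d d' : ℕ} (ha : 0 < a) (hb : 0 < b) (hc : 0 < c) (h : d ≤ d') :
    (H1P a b c d).card ≤ (H1P a b c d').card := by
  rw [card_H1P ha hb hc, card_H1P ha hb hc]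
  gcongr

end Counting

/-! ### Permissible parameters and minimal types -/

section Permissible

variable {a b c i s : ℕ}

theorem H1s_denominator_pos (ha : 2 ≤ a) (hb : 2 ≤ b) (hc : 2 ≤ c) :
    (0 : ℚ) < 2 * (a * b * c) - a - b - c - 1 := by
  have h : (a + b + c + 2 : ℚ) ≤ a * b * c := mod_cast add_add_le_mul_mul ha hb hc
  have h' : (0 : ℚ) ≤ a + b + c := by positivity
  linarith

theorem H1s_mono (ha : 2 ≤ a) (hb : 2 ≤ b) (hc : 2 ≤ c) {i' : ℕ} (h : i ≤ i') :
    H1s a b c i ≤ H1s a b c i' := by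
  have hd := H1s_denominator_pos ha hb hc
  have h' : (i : ℚ) ≤ i' := mod_cast h
  unfold H1s
  gcongr

/-- Both monomial counts carry the factor `abc / 2`; cancelling it leaves `2i + 11 - a - b - c ≤ s
(2abc - a - b - c - 1)`. -/
theorem h1Params_iff (ha : 2 ≤ a) (hab : a ≤ b) (hbc : b ≤ c) (hi : a * b * c ≤ i) :
    H1Params a b c i s ↔ H1s a b c i ≤ s := by
  have hb : 2 ≤ b := ha.trans hab
  have hc : 2 ≤ c := hb.trans hbc
  have habc := add_add_le_mul_mul ha hb hc
  have hd := H1s_denominator_pos ha hb hc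
  have hn : (0 : ℚ) < 2 * i - a - b - c + 11 := by
    have h : (a + b + c + 2 : ℚ) ≤ i := mod_cast habc.trans hi
    have h' : (0 : ℚ) ≤ a + b + c := by positivity
    linarith
  have h1 := two_mul_card_H1P (a := a) (b := b) (c := c) (d := i + 3) (by omega) (by omega)
    (by omega) (by omega)
  have h2 := two_mul_card_H1P (a := a) (b := b) (c := c) (d := i + a * b * c - (i + 3)) (by omega)
    (by omega) (by omega) (by omega)
  have hsub : ((i + a * b * c - (i + 3) : ℕ) : ℚ) = a * b * c - 3 := by
    rw [Nat.cast_sub (by omega)]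
    push_cast
    ring
  rw [hsub] at h2
  push_cast at h1
  have hpos : (0 : ℚ) < a * b * c := by
    exact_mod_cast (show 0 < a * b * c by omega)
  have key : (H1P a b c (i + 3)).card ≤ (H1P a b c (i + a * b * c - (i + 3)) ×ˢ
      (Finset.univ : Finset (Fin s))).card ↔ H1s a b c i ≤ s := by
    rw [Finset.card_product, Finset.card_univ, Fintype.card_fin, H1s, Nat.ceil_le,
      div_le_iff₀ hd, ← Nat.cast_le (α := ℚ), ← mul_le_mul_iff_right₀ (zero_lt_two' ℚ), h1,
      Nat.cast_mul, ← mul_assoc, h2, mul_assoc (a * b * c : ℚ), mul_le_mul_iff_right₀ hpos]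
    constructor <;> intro h <;> linarith
  refine ⟨fun h => key.mp h.sufficient, fun h => ⟨ha, hab, hbc, hi, ?_, key.mpr h⟩⟩
  exact (Nat.ceil_pos.mpr (div_pos hn hd)).trans_le h

/-- The choice `s = m_P(i + 3)` is permissible because `m_P(abc - 3) ≥ 1`, and `m_P(i + 3) ≤
m_P(j)`. Hence the cap `m_P(j)` on the dimension never cuts below the bound. -/
theorem H1s_le_card (ha : 2 ≤ a) (hab : a ≤ b) (hbc : b ≤ c) (hi : a * b * c ≤ i) :
    H1s a b c i ≤ (H1P a b c (i + a * b * c)).card := by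
  have hb : 2 ≤ b := ha.trans hab
  have hc : 2 ≤ c := hb.trans hbc
  have habc := add_add_le_mul_mul ha hb hc
  refine le_trans ?_ (card_H1P_mono (d := i + 3) (by omega) (by omega) (by omega) (by omega))
  have hne : multiIdx5 0 0 0 0 (i + 3) ∈ H1P a b c (i + 3) := by
    rw [multiIdx5_mem_H1P]
    omega
  have hne' : multiIdx5 0 0 0 0 (i + a * b * c - (i + 3)) ∈
      H1P a b c (i + a * b * c - (i + 3)) := by
    rw [multiIdx5_mem_H1P]
    omega
  refine (h1Params_iff ha hab hbc hi).mp ⟨ha, hab, hbc, hi, Finset.card_pos.mpr ⟨_, hne⟩, ?_⟩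
  rw [Finset.card_product, Finset.card_univ, Fintype.card_fin]
  exact Nat.le_mul_of_pos_left _ (Finset.card_pos.mpr ⟨_, hne'⟩)

/-- The smallest type, for fixed `(a, b, c, i)`. -/
theorem h1HasType_H1s (k : Type*) [Field k] [CharZero k] (ha : 2 ≤ a) (hab : a ≤ b) (hbc : b ≤ c)
    (hi : a * b * c ≤ i) : H1HasType k a b c i (H1s a b c i) (1 + H1s a b c i) := by
  have h := h1HasType_min k (i := i) ha (ha.trans hab) ((ha.trans hab).trans hbc)
    ((h1Params_iff ha hab hbc hi).mpr le_rfl).s_pos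
  rwa [min_eq_left (H1s_le_card ha hab hbc hi)] at h

theorem one_add_H1s_le_of_h1HasType {k : Type*} [Field k] [CharZero k] {t : ℕ}
    (hp : H1Params a b c i s) (ht : H1HasType k a b c i s t) : 1 + H1s a b c i ≤ t := by
  obtain ⟨ha, hab, hbc, hi, hs, -⟩ := id hp
  rw [ht.unique (h1HasType_min k ha (ha.trans hab) ((ha.trans hab).trans hbc) hs)]
  exact Nat.add_le_add_left
    (le_min ((h1Params_iff ha hab hbc hi).mp hp) (H1s_le_card ha hab hbc hi)) 1

theorem H1s_mul_mul_self (a b c : ℕ) : H1s a b c (a * b * c) =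
    ⌈(2 * (a * b * c) - a - b - c + 11 : ℚ) / (2 * (a * b * c) - a - b - c - 1)⌉₊ := by
  unfold H1s
  push_cast
  rfl

theorem one_add_H1s_mul_mul_self (ha : 2 ≤ a) (hab : a ≤ b) (hbc : b ≤ c) :
    1 + H1s a b c (a * b * c) = if a = 2 ∧ b = 2 ∧ c = 2 then 4 else 3 := by
  have hb : 2 ≤ b := ha.trans hab
  have hd := H1s_denominator_pos ha hb (hb.trans hbc)
  rw [H1s_mul_mul_self]
  split_ifs with h
  -- Here the quotient is `21 / 9`, strictly between 2 and 3.
  · obtain ⟨rfl, rfl, rfl⟩ := h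
    suffices hceil : ⌈(2 * ((2 : ℕ) * (2 : ℕ) * (2 : ℕ)) - (2 : ℕ) - (2 : ℕ) - (2 : ℕ) + 11 : ℚ) /
        (2 * ((2 : ℕ) * (2 : ℕ) * (2 : ℕ)) - (2 : ℕ) - (2 : ℕ) - (2 : ℕ) - 1)⌉₊ = 3 by
      rw [hceil]
    rw [Nat.ceil_eq_iff three_ne_zero]
    norm_num
  · have hc : 3 ≤ c := by omega
    -- Equivalent to the quotient being at most 2.
    have h13 : a + b + c + 13 ≤ 2 * (a * b * c) := by
      obtain ⟨x, rfl⟩ := Nat.exists_eq_add_of_le' ha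
      obtain ⟨y, rfl⟩ := Nat.exists_eq_add_of_le' hb
      obtain ⟨z, rfl⟩ := Nat.exists_eq_add_of_le' hc
      ring_nf
      omega
    have h13' : (a + b + c + 13 : ℚ) ≤ 2 * (a * b * c) := mod_cast h13
    suffices hceil : ⌈(2 * (a * b * c) - a - b - c + 11 : ℚ) /
        (2 * (a * b * c) - a - b - c - 1)⌉₊ = 2 by
      rw [hceil]
    rw [Nat.ceil_eq_iff two_ne_zero, lt_div_iff₀ hd, div_le_iff₀ hd]
    constructor
    · norm_num
      linarith
    · push_cast
      linarith

end Permissible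

end LevelAlg

theorem mainTheorem12 (k : Type*) [Field k] [IsAlgClosed k] [CharZero k] (a b c : ℕ)
    (ha : 2 ≤ a) (hab : a ≤ b) (hbc : b ≤ c) :
    -- (i) fixed `a, b, c, i`
    (∀ i : ℕ, a * b * c ≤ i →
      LevelAlg.H1Params a b c i (LevelAlg.H1s a b c i) ∧
      LevelAlg.H1HasType k a b c i (LevelAlg.H1s a b c i) (1 + LevelAlg.H1s a b c i) ∧
      IsLeast {t : ℕ | ∃ s, LevelAlg.H1Params a b c i s ∧ LevelAlg.H1HasType k a b c i s t}
        (1 + LevelAlg.H1s a b c i)) ∧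
    -- (ii) fixed `a, b, c`: the optimum is attained at `i = abc`
    (∃ s₀ : ℕ,
      s₀ = ⌈(2 * (a * b * c) - a - b - c + 11 : ℚ) / (2 * (a * b * c) - a - b - c - 1)⌉₊ ∧
      LevelAlg.H1Params a b c (a * b * c) s₀ ∧
      LevelAlg.H1HasType k a b c (a * b * c) s₀ (1 + s₀) ∧
      IsLeast {t : ℕ | ∃ i s, LevelAlg.H1Params a b c i s ∧ LevelAlg.H1HasType k a b c i s t}
        (1 + s₀) ∧
      1 + s₀ = if a = 2 ∧ b = 2 ∧ c = 2 then 4 else 3) ∧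
    -- (iii) every permissible choice has a general type, and it is at least `3`
    (∀ i s : ℕ, LevelAlg.H1Params a b c i s →
      (∃ t : ℕ, LevelAlg.H1HasType k a b c i s t) ∧
      ∀ t : ℕ, LevelAlg.H1HasType k a b c i s t → 3 ≤ t) := by
  have hb : 2 ≤ b := ha.trans hab
  have hc : 2 ≤ c := hb.trans hbc
  have hparams (i : ℕ) (hi : a * b * c ≤ i) : LevelAlg.H1Params a b c i (LevelAlg.H1s a b c i) :=
    (LevelAlg.h1Params_iff ha hab hbc hi).mpr le_rfl
  have htype (i : ℕ) (hi : a * b * c ≤ i) := LevelAlg.h1HasType_H1s k ha hab hbc hi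
  -- Monotonicity in `i` reduces every lower bound to `i = abc`.
  have hlower {i s t : ℕ} (hp : LevelAlg.H1Params a b c i s)
      (ht : LevelAlg.H1HasType k a b c i s t) : 1 + LevelAlg.H1s a b c (a * b * c) ≤ t :=
    (Nat.add_le_add_left (LevelAlg.H1s_mono ha hb hc hp.le_i) 1).trans
      (LevelAlg.one_add_H1s_le_of_h1HasType hp ht)
  have hval := LevelAlg.one_add_H1s_mul_mul_self ha hab hbc
  refine ⟨fun i hi => ⟨hparams i hi, htype i hi, ⟨_, hparams i hi, htype i hi⟩, ?_⟩,
    ⟨LevelAlg.H1s a b c (a * b * c), LevelAlg.H1s_mul_mul_self a b c, hparams _ le_rfl,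
      htype _ le_rfl, ⟨⟨_, _, hparams _ le_rfl, htype _ le_rfl⟩, ?_⟩, hval⟩,
    fun i s hp => ⟨⟨_, LevelAlg.h1HasType_min k ha hb hc hp.s_pos⟩, fun t ht => ?_⟩⟩
  · rintro t ⟨s, hp, ht⟩
    exact LevelAlg.one_add_H1s_le_of_h1HasType hp ht
  · rintro t ⟨i, s, hp, ht⟩
    exact hlower hp ht
  · refine le_trans ?_ (hlower hp ht)
    rw [hval]
    split_ifs <;> norm_num
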